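/- Let $n\ge 1$ agents have equal entitlements $b_i=\frac1n$ to a finite set $\mathcal M$ of indivisible items. A valuation is a function $v:2^{\mathcal M}\to\mathbb R_{\ge 0}$ with $v(\emptyset)=0$ that is monotone; it is submodular if $v(S)+v(T)\ge v(S\cup T)+v(S\cap T)$ for all $S,T\subseteq\mathcal M$. The maximin share $MMS_p$ of an agent $p$ with valuation $v_p$ is the maximum, over all partitions of $\mathcal M$ into $n$ (possibly empty) bundles, of the minimum $v_p$-value of a bundle. In the $\rho$-altruistic bidding game every agent $i$ starts with budget $b_i$ and an empty bundle, and is active as long as she has spent less than $\rho b_i$. In every round, every active agent submits a nonnegative bid not exceeding her remaining budget; an active agent with the highest bid wins (ties are broken arbitrarily), pays her bid, and takes an unallocated item of her choice. The game ends when no item is left or no agent is active. Agent $p$ uses the proportional strategy if she first truncates her valuation at $MMS_p$ and scales it so that her maximin share becomes $b_p$, that is, replaces $v_p$ by $u(S)=\frac{b_p}{MMS_p}\min\{v_p(S),MMS_p\}$ (if $MMS_p=0$ the claim below is trivial), then in every round in which she is active bids the minimum of her remaining budget and $\max_e\,[u(C\cup\{e\})-u(C)]$, where $C$ is the bundle that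 she already holds and $e$ ranges over the unallocated items, and, whenever she wins, takes an item $e$ that attains this maximum (ties broken arbitrarily). Theorem 2. There is an absolute constant $c>0$ such that for every $n\ge 1$ and every $0<\rho\le\frac{10}{27}+\frac cn$ (in particular for $\rho=\frac{10}{27}+\frac cn$) the following holds. In the $\rho$-altruistic bidding game with $n$ agents and equal entitlements, every agent $p$ with a submodular valuation $v_p$ that uses the proportional strategy ends the game with a bundle of $v_p$-value at least $\rho\cdot MMS_p$, whatever the bids and choices of the other agents. -/

import Mathlib

noncomputable section

namespace BiddingGame

/-- A normalized, monotone, submodular valuation over subsets of the finite set `M` of items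
(nonnegativity follows from the first two conditions). -/
structure IsSubmodularValuation {M : Type*} [DecidableEq M] (v : Finset M → ℝ) : Prop where
  normalized : v ∅ = 0
  monotone : Monotone v
  submodular : ∀ S T : Finset M, v (S ∪ T) + v (S ∩ T) ≤ v S + v T

/-- The maximin share: the maximum over all partitions of the items into `n` (possibly empty)
bundles of the smallest value of a bundle. A partition is given by the map sending each item to
the index of its bundle. For `1 ≤ n` the maximum and the minimum run over nonempty finite
families. -/
def mms {M : Type*} [Fintype M] [DecidableEq M] (n : ℕ) (v : Finset M → ℝ) : ℝ :=
  ⨆ A : M → Fin n, ⨅ j : Fin n, v (Finset.univ.filter fun e => A e = j)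

/-- The marginal value of the item `e` with respect to the bundle `C`. -/
def marginal {M : Type*} [DecidableEq M] (v : Finset M → ℝ) (e : M) (C : Finset M) : ℝ :=
  v (insert e C) - v C

/-- A position of the game: the bundle and the remaining budget of every agent, and the set of
unallocated items. -/
structure State (n : ℕ) (M : Type*) where
  bundle : Fin n → Finset M
  budget : Fin n → ℝ
  remaining : Finset M

/-- The initial position, when the entitlements (initial budgets) are `b`. -/
def initial {n : ℕ} {M : Type*} [Fintype M] (b : Fin n → ℝ) : State n M where
  bundle := fun _ => ∅
  budget := b
  remaining := Finset.univ

/-- What happens in one round: the bids, the winner, and the item that the winner selects. The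
bids of inactive agents are meaningless and are ignored. -/
structure Round (n : ℕ) (M : Type*) where
  bid : Fin n → ℝ
  winner : Fin n
  item : M

/-- In the `ρ`-altruistic game an agent is active as long as she has spent less than a
`ρ`-fraction of her initial budget. For `ρ = 1` this says that her budget is not exhausted. -/
def State.Active {n : ℕ} {M : Type*} (s : State n M) (ρ : ℝ) (b : Fin n → ℝ) (i : Fin n) : Prop :=
  b i - s.budget i < ρ * b i

/-- The rules of a round: every active agent makes a nonnegative bid that does not exceed her
remaining budget, the winner is an active agent with the highest bid (ties are broken
arbitrarily), and she selects an unallocated item. -/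
structure Round.Legal {n : ℕ} {M : Type*} (r : Round n M) (s : State n M) (ρ : ℝ)
    (b : Fin n → ℝ) : Prop where
  bid_nonneg : ∀ i, s.Active ρ b i → 0 ≤ r.bid i
  bid_le_budget : ∀ i, s.Active ρ b i → r.bid i ≤ s.budget i
  winner_active : s.Active ρ b r.winner
  winner_highest : ∀ i, s.Active ρ b i → r.bid i ≤ r.bid r.winner
  item_mem : r.item ∈ s.remaining

/-- The position after a round: the winner pays her bid and receives the item. -/
def State.next {n : ℕ} {M : Type*} [DecidableEq M] (s : State n M) (r : Round n M) :
    State n M where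
  bundle := Function.update s.bundle r.winner (insert r.item (s.bundle r.winner))
  budget := Function.update s.budget r.winner (s.budget r.winner - r.bid r.winner)
  remaining := s.remaining.erase r.item

/-- The game ends when all items are allocated or no agent is active. -/
def State.Terminal {n : ℕ} {M : Type*} (s : State n M) (ρ : ℝ) (b : Fin n → ℝ) : Prop :=
  s.remaining = ∅ ∨ ∀ i, ¬ s.Active ρ b i

/-- The valuation `v` truncated at its maximin share for `n` agents, and then scaled so that the
maximin share becomes the entitlement `β`. -/
def scaledValuation {M : Type*} [Fintype M] [DecidableEq M] (n : ℕ) (v : Finset M → ℝ) (β : ℝ)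
    (S : Finset M) : ℝ :=
  β / mms n v * min (v S) (mms n v)

/-- In this round agent `p`, whose valuation is `v`, uses the proportional strategy: if she is
active she bids the highest marginal value, with respect to the bundle that she already holds, of
an unallocated item, or her whole remaining budget if that is smaller; if she wins, she selects
an unallocated item of highest marginal value (with arbitrary tie-breaking). All marginal values
refer to the truncated and scaled valuation. -/
def Round.Proportional {n : ℕ} {M : Type*} [Fintype M] [DecidableEq M] (r : Round n M)
    (s : State n M) (ρ : ℝ) (b : Fin n → ℝ) (v : Finset M → ℝ) (p : Fin n) : Prop :=
  (s.Active ρ b p →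
    r.bid p = min
      (⨆ e : {e : M // e ∈ s.remaining},
        marginal (scaledValuation n v (b p)) e.1 (s.bundle p))
      (s.budget p)) ∧
  (r.winner = p →
    ∀ e ∈ s.remaining,
      marginal (scaledValuation n v (b p)) e (s.bundle p) ≤
        marginal (scaledValuation n v (b p)) r.item (s.bundle p))

/-- One round of the `ρ`-altruistic game with entitlements `b`, in which agent `p` uses the
proportional strategy and the other agents act arbitrarily within the rules. -/
def Step {n : ℕ} {M : Type*} [Fintype M] [DecidableEq M] (ρ : ℝ) (b : Fin n → ℝ)
    (v : Finset M → ℝ) (p : Fin n) (s s' : State n M) : Prop :=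
  ∃ r : Round n M, r.Legal s ρ b ∧ r.Proportional s ρ b v p ∧ s' = s.next r

/-- `s` is the final position of some complete run of the `ρ`-altruistic game with entitlements
`b`, in which agent `p`, with valuation `v`, uses the proportional strategy throughout and the
other agents act arbitrarily within the rules. -/
def IsOutcome {n : ℕ} {M : Type*} [Fintype M] [DecidableEq M] (ρ : ℝ) (b : Fin n → ℝ)
    (v : Finset M → ℝ) (p : Fin n) (s : State n M) : Prop :=
  Relation.ReflTransGen (Step ρ b v p) (initial b) s ∧ s.Terminal ρ b

end BiddingGame

end

noncomputable section

namespace BiddingGame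

/-! ### A weighting function

`packingWeight` inverts the weighting function from the analysis of First Fit bin packing. -/

/-! Suppose `p` ends below the threshold `ρ * β`, where `u` is the truncated, scaled valuation. She
pays exactly the marginal value of each item she wins, so her spending equals the value of her
bundle `C`; hence she is active throughout and the items run out. Price every item at her bid in the
round in which it goes. By submodularity these bids never increase, and each price is at least the
final marginal value of its item with respect to `C`.

The prices, divided by `ρ * β`, are compared through a weight. Another agent pays at least the price
of each of her items, and has spent less than the threshold before her last and cheapest one, so her
bundle has weight at most `1` (`sum_map_packingWeight_add_le_one`). A bundle of a maximin partition
has value `β`, so outside `C` its prices sum to at least `β - ρ * β`. At `ρ = 10 / 27` this is `17 /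
10` thresholds, which forces weight at least `1` (`one_le_sum_map_packingWeight`). The `n` maximin
bundles would then weigh at least `n` outside `C`, against at most `n - 1` for the bundles of the
others. The gap of `1` absorbs a loss of order `1 / n` per bundle, hence the gain `c / n`. -/

/-- The weight of an item whose price, as a fraction of the spending threshold, is `x`. -/
def packingWeight (x : ℝ) : ℝ :=
  if x < 1 / 5 then 5 / 6 * x
  else if x < 1 / 2 then 5 / 9 * x + 1 / 18
  else if x < 7 / 10 then 5 / 6 * x - 1 / 12
  else if x < 1 then 1 / 2
  else 1

theorem packingWeight_nonneg {x : ℝ} (hx : 0 ≤ x) : 0 ≤ packingWeight x := by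
  unfold packingWeight
  split_ifs <;> linarith

theorem packingWeight_le_mul {x : ℝ} (hx : x < 1) :
    packingWeight x ≤ 5 / 6 * x := by
  unfold packingWeight
  split_ifs <;> linarith

theorem packingWeight_le_half {x : ℝ} (hx : x < 1) : packingWeight x ≤ 1 / 2 := by
  unfold packingWeight
  split_ifs <;> linarith

theorem packingWeight_of_lt {x : ℝ} (hx : x < 1 / 5) : packingWeight x = 5 / 6 * x := by
  rw [packingWeight, if_pos hx]

theorem packingWeight_of_mem_Ico {x : ℝ} (h0 : 1 / 5 ≤ x) (hx : x < 1 / 2) :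
    packingWeight x = 5 / 9 * x + 1 / 18 := by
  rw [packingWeight, if_neg (not_lt.2 h0), if_pos hx]

theorem half_le_packingWeight {x : ℝ} (hx : 7 / 10 ≤ x) : 1 / 2 ≤ packingWeight x := by
  unfold packingWeight
  split_ifs <;> linarith

theorem packingWeight_of_one_le {x : ℝ} (hx : 1 ≤ x) : packingWeight x = 1 := by
  unfold packingWeight
  split_ifs <;> linarith

/-- The ratio of weight to price is smallest at `1 / 2`, where the weight is `1 / 3`. -/
theorem two_thirds_mul_le_packingWeight {x : ℝ} (h0 : 0 ≤ x) (hx : x ≤ 7 / 10) :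
    2 / 3 * x ≤ packingWeight x := by
  unfold packingWeight
  split_ifs <;> linarith

/-- Equality holds at `7 / 20`, whose weight is `1 / 4`; two such prices are a tight case of
`half_le_sum_map_packingWeight`. -/
theorem five_sevenths_mul_le_packingWeight {x : ℝ} (h0 : 0 ≤ x) (hx : x ≤ 7 / 20) :
    5 / 7 * x ≤ packingWeight x := by
  unfold packingWeight
  split_ifs <;> linarith

theorem packingWeight_monotone {x y : ℝ} (hxy : x ≤ y) :
    packingWeight x ≤ packingWeight y := by
  unfold packingWeight
  split_ifs <;> linarith

theorem le_sum_of_mem {s : Multiset ℝ} (hs : ∀ a ∈ s, 0 ≤ a) {a : ℝ} (ha : a ∈ s) :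
    a ≤ s.sum :=
  Multiset.single_le_sum hs a ha

theorem packingWeight_le_sum_map {s : Multiset ℝ} (hs : ∀ a ∈ s, 0 ≤ a) {a : ℝ} (ha : a ∈ s) :
    packingWeight a ≤ (s.map packingWeight).sum := by
  apply Multiset.single_le_sum _ _ (Multiset.mem_map_of_mem _ ha)
  intro x hx
  obtain ⟨a, ha, rfl⟩ := Multiset.mem_map.1 hx
  exact packingWeight_nonneg (hs a ha)

theorem mul_sum_le_sum_map_packingWeight {s : Multiset ℝ} {k : ℝ}
    (hs : ∀ a ∈ s, k * a ≤ packingWeight a) : k * s.sum ≤ (s.map packingWeight).sum := by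
  have h : (s.map fun a => k * a).sum = k * s.sum := by
    rw [Multiset.sum_map_mul_left, Multiset.map_id']
  exact h ▸ Multiset.sum_map_le_sum_map (fun a => k * a) packingWeight hs

theorem sum_map_packingWeight_le_mul_sum {s : Multiset ℝ} {k : ℝ}
    (hs : ∀ a ∈ s, packingWeight a ≤ k * a) : (s.map packingWeight).sum ≤ k * s.sum := by
  have h : (s.map fun a => k * a).sum = k * s.sum := by
    rw [Multiset.sum_map_mul_left, Multiset.map_id']
  exact h ▸ Multiset.sum_map_le_sum_map packingWeight (fun a => k * a) hs

/-- If prices below the threshold are followed by one that is at most each of them, then their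
total weight is at most `1`. -/
theorem sum_map_packingWeight_add_le_one {s : Multiset ℝ} {x : ℝ} (hx : 0 ≤ x)
    (hs : ∀ a ∈ s, x ≤ a) (hsum : s.sum < 1) :
    (s.map packingWeight).sum + packingWeight x ≤ 1 := by
  have h0 : ∀ a ∈ s, 0 ≤ a := fun a ha => hx.trans (hs a ha)
  have h1 : ∀ a ∈ s, a < 1 := fun a ha => (le_sum_of_mem h0 ha).trans_lt hsum
  rcases s.empty_or_exists_mem with rfl | ⟨a₀, ha₀⟩
  · rcases lt_or_ge x 1 with h | h
    · have := packingWeight_le_half h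
      simp; linarith
    · simp [packingWeight_of_one_le h]
  have hx1 : x < 1 := (hs a₀ ha₀).trans_lt (h1 a₀ ha₀)
  rcases lt_or_ge x (1 / 5) with hx5 | hx5
  · have := sum_map_packingWeight_le_mul_sum (s := s) (k := 5 / 6)
      fun a ha => packingWeight_le_mul (h1 a ha)
    rw [packingWeight_of_lt hx5]
    linarith
  -- With all prices at least `1 / 5`, at most two fit beside one of `1 / 2` or more. The inductions
  -- below only split on their number.
  by_cases hbig : ∃ a ∈ s, 1 / 2 ≤ a
  · obtain ⟨a, ha, hab⟩ := hbig
    obtain ⟨t, rfl⟩ := Multiset.exists_cons_of_mem ha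
    have ha1 := h1 a ha
    induction t using Multiset.induction with
    | empty =>
      have h2 := packingWeight_le_half ha1
      have h3 := packingWeight_le_half hx1
      simp; linarith
    | cons y t _ =>
      have hy : x ≤ y := hs y (by simp)
      induction t using Multiset.induction with
      | empty =>
        simp only [Multiset.sum_cons, Multiset.sum_zero, Multiset.map_cons, Multiset.map_zero]
          at hsum ⊢
        rw [packingWeight_of_mem_Ico (x := x) hx5 (by linarith),
          packingWeight_of_mem_Ico (x := y) (by linarith) (by linarith)]
        unfold packingWeight
        split_ifs <;> linarith
      | cons z t _ =>
        have hz : x ≤ z := hs z (by simp)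
        induction t using Multiset.induction with
        | empty =>
          simp only [Multiset.sum_cons, Multiset.sum_zero, Multiset.map_cons, Multiset.map_zero]
            at hsum ⊢
          rw [packingWeight_of_mem_Ico (x := x) hx5 (by linarith),
            packingWeight_of_mem_Ico (x := y) (by linarith) (by linarith),
            packingWeight_of_mem_Ico (x := z) (by linarith) (by linarith)]
          unfold packingWeight
          split_ifs <;> linarith
        | cons q t _ =>
          have hq : x ≤ q := hs q (by simp)
          have ht : 0 ≤ t.sum := Multiset.sum_nonneg fun b hb => h0 b (by simp [hb])
          simp only [Multiset.sum_cons] at hsum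
          linarith
  · push Not at hbig
    have hx2 : x < 1 / 2 := (hs a₀ ha₀).trans_lt (hbig a₀ ha₀)
    have hval : (s.map packingWeight).sum = 5 / 9 * s.sum + s.card / 18 := by
      rw [Multiset.map_congr rfl fun a ha =>
        packingWeight_of_mem_Ico (hx5.trans (hs a ha)) (hbig a ha)]
      rw [Multiset.sum_map_add, Multiset.sum_map_mul_left, Multiset.map_id', Multiset.map_const',
        Multiset.sum_replicate, nsmul_eq_mul]
      ring
    have hcard : s.card * x ≤ s.sum := by
      simpa using Multiset.card_nsmul_le_sum hs
    have hcard' : s.sum ≤ s.card * (1 / 2) := by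
      simpa using Multiset.sum_le_card_nsmul s (1 / 2) fun a ha => (hbig a ha).le
    rw [hval, packingWeight_of_mem_Ico hx5 hx2]
    -- The weight is now affine on all the prices, which leaves one inequality per cardinality.
    -- Cardinality two is tight, with three prices near `1 / 2` of weight near `1 / 3` each.
    have hlt : s.card < 5 := by
      by_contra h
      have : (5 : ℝ) ≤ s.card := by exact_mod_cast not_lt.1 h
      nlinarith
    generalize s.card = k at *
    interval_cases k <;> norm_num at * <;> linarith

/-- Prices of at most `7 / 10` of the threshold with sum at least `7 / 10` have total weight at
least `1 / 2`. -/
theorem half_le_sum_map_packingWeight {s : Multiset ℝ} (h0 : ∀ a ∈ s, 0 ≤ a)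
    (hs : ∀ a ∈ s, a < 7 / 10) (hsum : 7 / 10 ≤ s.sum) :
    1 / 2 ≤ (s.map packingWeight).sum := by
  by_cases hbig : ∃ y ∈ s, 7 / 20 < y
  swap
  · push Not at hbig
    have := mul_sum_le_sum_map_packingWeight (s := s) (k := 5 / 7)
      fun a ha => five_sevenths_mul_le_packingWeight (h0 a ha) (hbig a ha)
    linarith
  obtain ⟨y, hy, hyb⟩ := hbig
  obtain ⟨t, rfl⟩ := Multiset.exists_cons_of_mem hy
  have hy7 := hs y hy
  have ht0 : ∀ a ∈ t, 0 ≤ a := fun a ha => h0 a (by simp [ha])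
  simp only [Multiset.sum_cons, Multiset.map_cons] at hsum ⊢
  rcases lt_or_ge y (1 / 2) with hy2 | hy2
  · rw [packingWeight_of_mem_Ico (by linarith) hy2]
    -- The weights of `y` and `7 / 10 - y` add up to exactly `1 / 2`. If every other price is
    -- smaller than `7 / 10 - y`, the chord from `0` to that point bounds their weights from below.
    by_cases hr : ∃ a ∈ t, 7 / 10 - y ≤ a
    · obtain ⟨a, ha, hra⟩ := hr
      have h1 := packingWeight_le_sum_map ht0 ha
      have h2 := packingWeight_monotone hra
      rw [packingWeight_of_mem_Ico (x := 7 / 10 - y) (by linarith) (by linarith)] at h2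
      linarith
    · push Not at hr
      have hrpos : 0 < 7 / 10 - y := by linarith
      have h1 := mul_sum_le_sum_map_packingWeight (s := t)
        (k := (5 / 9 * (7 / 10 - y) + 1 / 18) / (7 / 10 - y)) (by
          intro a ha
          have haa := hr a ha
          have ha0 := ht0 a ha
          rw [div_mul_eq_mul_div, div_le_iff₀ hrpos]
          unfold packingWeight
          split_ifs <;> nlinarith)
      have h2 : (5 / 9 * (7 / 10 - y) + 1 / 18) / (7 / 10 - y) * (7 / 10 - y) ≤
          (5 / 9 * (7 / 10 - y) + 1 / 18) / (7 / 10 - y) * t.sum := by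
        apply mul_le_mul_of_nonneg_left (by linarith)
        apply div_nonneg <;> linarith
      rw [div_mul_cancel₀ _ hrpos.ne'] at h2
      linarith
  · have hyw : packingWeight y = 5 / 6 * y - 1 / 12 := by
      unfold packingWeight
      split_ifs <;> linarith
    rw [hyw]
    by_cases hr : ∃ a ∈ t, 1 / 5 ≤ a
    · obtain ⟨a, ha, hra⟩ := hr
      have h1 := packingWeight_le_sum_map ht0 ha
      have h2 := packingWeight_monotone hra
      rw [packingWeight_of_mem_Ico (x := 1 / 5) (by norm_num) (by norm_num)] at h2
      linarith
    · push Not at hr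
      have h1 := mul_sum_le_sum_map_packingWeight (s := t) (k := 5 / 6)
        fun a ha => (packingWeight_of_lt (hr a ha)).ge
      linarith

/-- Prices with sum at least `17 / 10` of the threshold have total weight at least `1`. -/
theorem one_le_sum_map_packingWeight {s : Multiset ℝ} (h0 : ∀ a ∈ s, 0 ≤ a)
    (hsum : 17 / 10 ≤ s.sum) : 1 ≤ (s.map packingWeight).sum := by
  by_cases hone : ∃ a ∈ s, 1 ≤ a
  · obtain ⟨a, ha, h⟩ := hone
    exact (packingWeight_of_one_le h).ge.trans (packingWeight_le_sum_map h0 ha)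
  push Not at hone
  -- Without such a price, slope `2 / 3` suffices. With one, it weighs at least `1 / 2` and the rest
  -- still sum to more than `7 / 10`.
  by_cases hbig : ∃ a ∈ s, 7 / 10 ≤ a
  swap
  · push Not at hbig
    have := mul_sum_le_sum_map_packingWeight (s := s) (k := 2 / 3)
      fun a ha => two_thirds_mul_le_packingWeight (h0 a ha) (hbig a ha).le
    linarith
  obtain ⟨a, ha, hab⟩ := hbig
  have ha1 := hone a ha
  have haw := half_le_packingWeight hab
  obtain ⟨t, rfl⟩ := Multiset.exists_cons_of_mem ha
  have ht0 : ∀ a ∈ t, 0 ≤ a := fun a ha => h0 a (by simp [ha])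
  simp only [Multiset.sum_cons, Multiset.map_cons] at hsum ⊢
  suffices 1 / 2 ≤ (t.map packingWeight).sum by linarith
  by_cases ht : ∃ b ∈ t, 7 / 10 ≤ b
  · obtain ⟨b, hb, hbb⟩ := ht
    exact (half_le_packingWeight hbb).trans (packingWeight_le_sum_map ht0 hb)
  · push Not at ht
    exact half_le_sum_map_packingWeight ht0 ht (by linarith)

/-! ### Submodular valuations -/

section Valuation

variable {M : Type*} [DecidableEq M] {v : Finset M → ℝ}

theorem IsSubmodularValuation.nonneg (hv : IsSubmodularValuation v) (S : Finset M) : 0 ≤ v S :=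
  hv.normalized ▸ hv.monotone (Finset.empty_subset S)

theorem marginal_of_mem {e : M} {C : Finset M} (he : e ∈ C) : marginal v e C = 0 := by
  simp [marginal, Finset.insert_eq_of_mem he]

theorem IsSubmodularValuation.marginal_nonneg (hv : IsSubmodularValuation v) (e : M)
    (C : Finset M) : 0 ≤ marginal v e C :=
  sub_nonneg.2 (hv.monotone (Finset.subset_insert e C))

theorem IsSubmodularValuation.marginal_antitone (hv : IsSubmodularValuation v) (e : M)
    {C D : Finset M} (hCD : C ⊆ D) : marginal v e D ≤ marginal v e C := by
  by_cases he : e ∈ D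
  · rw [marginal_of_mem he]
    exact hv.marginal_nonneg e C
  · have h := hv.submodular (insert e C) D
    rw [Finset.insert_union, Finset.union_eq_right.2 hCD, Finset.insert_inter_of_notMem he,
      Finset.inter_eq_left.2 hCD] at h
    unfold marginal
    linarith

theorem IsSubmodularValuation.sub_le_sum_marginal (hv : IsSubmodularValuation v)
    (C S : Finset M) : v (C ∪ S) - v C ≤ ∑ e ∈ S, marginal v e C := by
  induction S using Finset.induction_on with
  | empty => simp
  | insert a S ha ih =>
    rw [Finset.sum_insert ha, Finset.union_insert]
    have h := hv.marginal_antitone a (Finset.subset_union_left (s₁ := C) (s₂ := S))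
    have : marginal v a (C ∪ S) = v (insert a (C ∪ S)) - v (C ∪ S) := rfl
    linarith

variable [Fintype M]

theorem IsSubmodularValuation.scaledValuation (hv : IsSubmodularValuation v) {n : ℕ} {β : ℝ}
    (hβ : 0 ≤ β) (hm : 0 ≤ mms n v) :
    IsSubmodularValuation (BiddingGame.scaledValuation n v β) where
  normalized := by simp [BiddingGame.scaledValuation, hv.normalized, hm]
  monotone S T hST :=
    mul_le_mul_of_nonneg_left (min_le_min_right _ (hv.monotone hST)) (div_nonneg hβ hm)
  submodular S T := by
    simp only [BiddingGame.scaledValuation, ← mul_add]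
    apply mul_le_mul_of_nonneg_left _ (div_nonneg hβ hm)
    have hS := hv.monotone (Finset.subset_union_left (s₁ := S) (s₂ := T))
    have hT := hv.monotone (Finset.subset_union_right (s₁ := S) (s₂ := T))
    have hS' := hv.monotone (Finset.inter_subset_left (s₁ := S) (s₂ := T))
    have hT' := hv.monotone (Finset.inter_subset_right (s₁ := S) (s₂ := T))
    have h := hv.submodular S T
    have h1 := min_le_left (v (S ∪ T)) (mms n v)
    have h2 := min_le_right (v (S ∪ T)) (mms n v)
    have h3 := min_le_left (v (S ∩ T)) (mms n v)
    have h4 := min_le_right (v (S ∩ T)) (mms n v)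
    -- If `S` or `T` reaches the cap, its term bounds that of the union, and the other term bounds
    -- that of the intersection.
    rcases min_cases (v S) (mms n v) with h5 | h5 <;>
    rcases min_cases (v T) (mms n v) with h6 | h6 <;> linarith

theorem scaledValuation_le {n : ℕ} {β : ℝ} (hβ : 0 ≤ β) (hm : 0 < mms n v) (S : Finset M) :
    scaledValuation n v β S ≤ β := by
  have := mul_le_mul_of_nonneg_left (min_le_right (v S) (mms n v)) (div_nonneg hβ hm.le)
  rwa [div_mul_cancel₀ _ hm.ne'] at this

theorem exists_partition_mms_le (v : Finset M → ℝ) {n : ℕ} (hn : 1 ≤ n) :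
    ∃ A : M → Fin n, ∀ j, mms n v ≤ v (Finset.univ.filter fun e => A e = j) := by
  have : Nonempty (Fin n) := ⟨⟨0, hn⟩⟩
  obtain ⟨A, hA⟩ := exists_eq_ciSup_of_finite
    (f := fun A : M → Fin n => ⨅ j : Fin n, v (Finset.univ.filter fun e => A e = j))
  exact ⟨A, fun j => hA.symm.le.trans (ciInf_le (Set.finite_range _).bddBelow j)⟩

theorem exists_partition_scaledValuation_eq {n : ℕ} (hn : 1 ≤ n) {β : ℝ} (hm : 0 < mms n v) :
    ∃ A : M → Fin n, ∀ j,
      scaledValuation n v β (Finset.univ.filter fun e => A e = j) = β := by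
  obtain ⟨A, hA⟩ := exists_partition_mms_le v hn
  refine ⟨A, fun j => ?_⟩
  rw [scaledValuation, min_eq_right (hA j), div_mul_cancel₀ _ hm.ne']

end Valuation

/-! ### The course of the game -/

section Game

variable {n : ℕ} {M : Type*} [DecidableEq M]

/-- `w` records, for every allocated item, the bid of agent `p` in the round in which the item was
allocated, where `p` has valuation `u`, budget `β`, and is still active. -/
structure Ledger (u : Finset M → ℝ) (ρ β : ℝ) (p : Fin n) (s : State n M) (w : M → ℝ) :
    Prop where
  mem_remaining : ∀ e, e ∈ s.remaining ↔ ∀ i, e ∉ s.bundle i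
  disjoint : ∀ i j, i ≠ j → Disjoint (s.bundle i) (s.bundle j)
  budget_eq : s.budget p = β - u (s.bundle p)
  nonneg : ∀ e ∉ s.remaining, 0 ≤ w e
  marginal_le : ∀ e ∉ s.remaining, marginal u e (s.bundle p) ≤ w e
  marginal_remaining_le : ∀ e ∉ s.remaining, ∀ e' ∈ s.remaining,
    marginal u e' (s.bundle p) ≤ w e
  sum_le_spent : ∀ i, i ≠ p → ∑ e ∈ s.bundle i, w e ≤ β - s.budget i
  exists_last : ∀ i, i ≠ p → (s.bundle i).Nonempty →
    ∃ e ∈ s.bundle i, ∑ e' ∈ (s.bundle i).erase e, w e' < ρ * β ∧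
      ∀ e' ∈ s.bundle i, w e ≤ w e'

/-- An active agent whose value never exceeds her budget bids the highest marginal value. -/
theorem isGreatest_bid {u : Finset M → ℝ} {β : ℝ} {p : Fin n}
    {s : State n M} (hub : ∀ S, u S ≤ β) (hbudget : s.budget p = β - u (s.bundle p))
    (hne : s.remaining.Nonempty) {x : ℝ}
    (hx : x = min (⨆ e : {e : M // e ∈ s.remaining}, marginal u e.1 (s.bundle p))
      (s.budget p)) :
    IsGreatest ((fun e => marginal u e (s.bundle p)) '' s.remaining) x := by
  have : Nonempty {e : M // e ∈ s.remaining} := hne.to_subtype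
  have hbdd : BddAbove (Set.range fun e : {e : M // e ∈ s.remaining} =>
    marginal u e.1 (s.bundle p)) := (Set.finite_range _).bddAbove
  rw [min_eq_left] at hx
  · constructor
    · obtain ⟨e, he⟩ := exists_eq_ciSup_of_finite
        (f := fun e : {e : M // e ∈ s.remaining} => marginal u e.1 (s.bundle p))
      exact ⟨e.1, e.2, by simp only [he, hx]⟩
    · rintro _ ⟨e, he, rfl⟩
      rw [hx]
      exact le_ciSup hbdd ⟨e, he⟩
  -- Truncation keeps every marginal value within `β - u (s.bundle p)`, so the budget cap never
  -- binds.
  · apply ciSup_le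
    intro e
    rw [hbudget]
    exact sub_le_sub_right (hub _) _

theorem State.bundle_subset_next (s : State n M) (r : Round n M) (i : Fin n) :
    s.bundle i ⊆ (s.next r).bundle i := by
  intro e he
  by_cases h : i = r.winner
  · subst h
    simp [State.next, he]
  · simpa [State.next, h] using he

/-- The new bid of `p` is the marginal value of a remaining item, so no earlier price is below it.
Thus the item just sold is the cheapest in the winner's bundle, and the winner, active until now,
had spent less than the threshold before it. -/
theorem Ledger.next {u : Finset M → ℝ} (hu : IsSubmodularValuation u) {ρ β : ℝ} {p : Fin n}
    {s : State n M} {w : M → ℝ} (hw : Ledger u ρ β p s w) {r : Round n M}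
    (hr : r.Legal s ρ fun _ => β) (hp : s.Active ρ (fun _ => β) p)
    (hbid : IsGreatest ((fun e => marginal u e (s.bundle p)) '' s.remaining) (r.bid p))
    (hitem : r.winner = p → marginal u r.item (s.bundle p) = r.bid p) :
    Ledger u ρ β p (s.next r) (Function.update w r.item (r.bid p)) := by
  have hnot : ∀ i, r.item ∉ s.bundle i := (hw.mem_remaining _).1 hr.item_mem
  have hmax : ∀ e ∈ s.remaining, marginal u e (s.bundle p) ≤ r.bid p :=
    fun e he => hbid.2 ⟨e, he, rfl⟩
  have hanti : ∀ e, marginal u e ((s.next r).bundle p) ≤ marginal u e (s.bundle p) :=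
    fun e => hu.marginal_antitone e (s.bundle_subset_next r p)
  have hrem : (s.next r).remaining = s.remaining.erase r.item := rfl
  have hcases : ∀ e ∉ (s.next r).remaining, e = r.item ∨ e ≠ r.item ∧ e ∉ s.remaining := by
    intro e he
    rw [hrem, Finset.mem_erase, not_and_or, not_not] at he
    tauto
  have hold : ∀ e ∉ s.remaining, r.bid p ≤ w e := by
    obtain ⟨e', he', h⟩ := hbid.1
    intro e he
    rw [← h]
    exact hw.marginal_remaining_le e he e' he'
  have hwin : (s.next r).bundle r.winner = insert r.item (s.bundle r.winner) := by
    simp [State.next]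
  have hlose : ∀ i, i ≠ r.winner → (s.next r).bundle i = s.bundle i := by
    intro i hi
    simp [State.next, hi]
  have halloc : ∀ i, ∀ e ∈ s.bundle i, e ∉ s.remaining := fun i e he h =>
    (hw.mem_remaining e).1 h i he
  have hupd : ∀ i, ∀ e ∈ s.bundle i, Function.update w r.item (r.bid p) e = w e := by
    intro i e he
    apply Function.update_of_ne
    rintro rfl
    exact hnot i he
  have hsum : ∀ i, ∑ e ∈ s.bundle i, Function.update w r.item (r.bid p) e =
      ∑ e ∈ s.bundle i, w e := fun i => Finset.sum_congr rfl (hupd i)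
  constructor
  · intro e
    rw [hrem, Finset.mem_erase, hw.mem_remaining]
    constructor
    · rintro ⟨he, h⟩ i
      by_cases hi : i = r.winner
      · subst hi
        simp [hwin, he, h]
      · simp [hlose i hi, h]
    · intro h
      refine ⟨?_, fun i hi => h i (s.bundle_subset_next r i hi)⟩
      rintro rfl
      exact h r.winner (by simp [hwin])
  · intro i j hij
    by_cases hi : i = r.winner
    · subst hi
      rw [hwin, hlose j hij.symm, Finset.disjoint_insert_left]
      exact ⟨hnot j, hw.disjoint _ _ hij⟩
    · by_cases hj : j = r.winner
      · subst hj
        rw [hwin, hlose i hij, Finset.disjoint_insert_right]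
        exact ⟨hnot i, hw.disjoint _ _ hij⟩
      · rw [hlose i hi, hlose j hj]
        exact hw.disjoint _ _ hij
  · by_cases h : r.winner = p
    · have h1 := hitem h
      subst h
      rw [hwin]
      have h2 : (s.next r).budget r.winner = s.budget r.winner - r.bid r.winner := by
        simp [State.next]
      rw [h2, hw.budget_eq, ← h1, marginal]
      ring
    · rw [hlose p (Ne.symm h), ← hw.budget_eq]
      simp [State.next, Ne.symm h]
  · intro e he
    rcases hcases e he with rfl | ⟨hne, he⟩
    · simpa using hr.bid_nonneg p hp
    · rw [Function.update_of_ne hne]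
      exact hw.nonneg e he
  · intro e he
    rcases hcases e he with rfl | ⟨hne, he⟩
    · rw [Function.update_self]
      exact (hanti _).trans (hmax _ hr.item_mem)
    · rw [Function.update_of_ne hne]
      exact (hanti _).trans (hw.marginal_le e he)
  · intro e he e' he'
    have he'' : e' ∈ s.remaining := Finset.mem_of_mem_erase he'
    rcases hcases e he with rfl | ⟨hne, he⟩
    · rw [Function.update_self]
      exact (hanti _).trans (hmax _ he'')
    · rw [Function.update_of_ne hne]
      exact (hanti _).trans (hw.marginal_remaining_le e he e' he'')
  · intro i hi
    by_cases h : i = r.winner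
    · subst h
      rw [hwin, Finset.sum_insert (hnot _), hsum, Function.update_self]
      have h1 := hw.sum_le_spent _ hi
      have h2 := hr.winner_highest p hp
      have h3 : (s.next r).budget r.winner = s.budget r.winner - r.bid r.winner := by
        simp [State.next]
      linarith
    · rw [hlose i h, hsum]
      have h3 : (s.next r).budget i = s.budget i := by simp [State.next, h]
      rw [h3]
      exact hw.sum_le_spent i hi
  · intro i hi hne
    by_cases h : i = r.winner
    · subst h
      refine ⟨r.item, by simp [hwin], ?_, ?_⟩
      · rw [hwin, Finset.erase_insert (hnot _), hsum]
        exact (hw.sum_le_spent _ hi).trans_lt hr.winner_active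
      · rw [hwin, Function.update_self]
        intro e he
        rcases Finset.mem_insert.1 he with rfl | he
        · simp
        · rw [hupd _ e he]
          exact hold e (halloc _ e he)
    · rw [hlose i h] at hne ⊢
      obtain ⟨e, he, h1, h2⟩ := hw.exists_last i hi hne
      refine ⟨e, he, ?_, ?_⟩
      · rwa [Finset.sum_congr rfl fun e' he' => hupd i e' (Finset.mem_of_mem_erase he')]
      · intro e' he'
        rw [hupd i e he, hupd i e' he']
        exact h2 e' he'

/-! ### Weighing the bundles -/

/-- The bundle of every agent other than `p` has total weight at most `1`. -/
theorem Ledger.sum_packingWeight_le_one {u : Finset M → ℝ} {ρ β : ℝ} {p : Fin n}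
    {s : State n M} {w : M → ℝ} (hw : Ledger u ρ β p s w) (hρβ : 0 < ρ * β) {i : Fin n}
    (hi : i ≠ p) : ∑ e ∈ s.bundle i, packingWeight (w e / (ρ * β)) ≤ 1 := by
  rcases (s.bundle i).eq_empty_or_nonempty with h | h
  · simp [h]
  obtain ⟨e, he, hsum, hle⟩ := hw.exists_last i hi h
  have hnn : 0 ≤ w e := hw.nonneg e fun h => (hw.mem_remaining e).1 h i he
  have key := sum_map_packingWeight_add_le_one
    (s := ((s.bundle i).erase e).val.map fun e => w e / (ρ * β)) (div_nonneg hnn hρβ.le)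
    (by
      intro a ha
      obtain ⟨e', he', rfl⟩ := Multiset.mem_map.1 ha
      exact div_le_div_of_nonneg_right (hle e' (Finset.mem_of_mem_erase he')) hρβ.le)
    (by
      change ∑ e' ∈ (s.bundle i).erase e, w e' / (ρ * β) < 1
      rwa [← Finset.sum_div, div_lt_one hρβ])
  rw [Multiset.map_map] at key
  rw [← Finset.sum_erase_add _ _ he]
  exact key

/-- If the game ends while agent `p` is active, then every bundle `B` of full value has total
weight close to `1` outside the bundle of `p`. -/
theorem Ledger.le_sum_packingWeight {u : Finset M → ℝ} (hu : IsSubmodularValuation u)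
    {ρ β δ : ℝ} {p : Fin n} {s : State n M} {w : M → ℝ} (hw : Ledger u ρ β p s w)
    (hρβ : 0 < ρ * β) (hlt : u (s.bundle p) < ρ * β) (hrem : s.remaining = ∅)
    (hδ : 0 ≤ δ) (hδ' : δ < 1 / 5) (hδρ : (17 / 10 - δ) * (ρ * β) ≤ β - ρ * β)
    {B : Finset M} (hB : β ≤ u B) :
    1 - 5 / 6 * δ ≤ ∑ e ∈ B \ s.bundle p, packingWeight (w e / (ρ * β)) := by
  have hall : ∀ e, e ∉ s.remaining := by simp [hrem]
  have h1 := hu.sub_le_sum_marginal (s.bundle p) (B \ s.bundle p)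
  rw [Finset.union_sdiff_self_eq_union] at h1
  have h2 : u B ≤ u (s.bundle p ∪ B) := hu.monotone Finset.subset_union_right
  have h3 : ∑ e ∈ B \ s.bundle p, marginal u e (s.bundle p) ≤ ∑ e ∈ B \ s.bundle p, w e :=
    Finset.sum_le_sum fun e _ => hw.marginal_le e (hall e)
  have h4 : 17 / 10 - δ ≤ ∑ e ∈ B \ s.bundle p, w e / (ρ * β) := by
    rw [← Finset.sum_div, le_div_iff₀ hρβ]
    linarith
  -- A fictitious price `δ` lifts the sum to `17 / 10`; since `δ < 1 / 5`, its weight is only `5 / 6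
  -- * δ`.
  have key := one_le_sum_map_packingWeight
    (s := δ ::ₘ (B \ s.bundle p).val.map fun e => w e / (ρ * β))
    (by
      intro a ha
      rcases Multiset.mem_cons.1 ha with rfl | ha
      · exact hδ
      · obtain ⟨e, -, rfl⟩ := Multiset.mem_map.1 ha
        exact div_nonneg (hw.nonneg e (hall e)) hρβ.le)
    (by
      rw [Multiset.sum_cons]
      change 17 / 10 ≤ δ + ∑ e ∈ B \ s.bundle p, w e / (ρ * β)
      linarith)
  rw [Multiset.map_cons, Multiset.sum_cons, packingWeight_of_lt hδ', Multiset.map_map] at key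
  change 1 ≤ 5 / 6 * δ + ∑ e ∈ B \ s.bundle p, packingWeight (w e / (ρ * β)) at key
  linarith

variable [Fintype M]

theorem Ledger.initial {u : Finset M → ℝ} (hu : IsSubmodularValuation u) (ρ β : ℝ) (p : Fin n) :
    Ledger u ρ β p (BiddingGame.initial fun _ => β) fun _ => 0 where
  mem_remaining := by simp [BiddingGame.initial]
  disjoint := by simp [BiddingGame.initial]
  budget_eq := by simp [BiddingGame.initial, hu.normalized]
  nonneg := by simp
  marginal_le := by simp [BiddingGame.initial]
  marginal_remaining_le := by simp [BiddingGame.initial]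
  sum_le_spent := by simp [BiddingGame.initial]
  exists_last := by simp [BiddingGame.initial]

/-- As long as agent `p` has not reached the value at which she turns inactive, the position
admits a ledger. -/
theorem exists_ledger {v : Finset M → ℝ} {ρ β : ℝ} {p : Fin n} {s : State n M}
    (hv : IsSubmodularValuation v) (hβ : 0 ≤ β) (hm : 0 < mms n v)
    (hs : Relation.ReflTransGen (Step ρ (fun _ => β) v p) (initial fun _ => β) s)
    (hlt : scaledValuation n v β (s.bundle p) < ρ * β) :
    ∃ w, Ledger (scaledValuation n v β) ρ β p s w := by
  have hu := hv.scaledValuation hβ hm.le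
  induction hs with
  | refl => exact ⟨_, Ledger.initial hu ρ β p⟩
  | @tail s s' _ hstep ih =>
    obtain ⟨r, hr, hprop, rfl⟩ := hstep
    -- Bundles only grow, so a final value below the threshold was below it in every earlier
    -- position.
    have hlt' := (hu.monotone (s.bundle_subset_next r p)).trans_lt hlt
    obtain ⟨w, hw⟩ := ih hlt'
    have hp : s.Active ρ (fun _ => β) p := by
      have := hw.budget_eq
      simp only [State.Active]
      linarith
    have hbid := isGreatest_bid (scaledValuation_le hβ hm) hw.budget_eq
      ⟨_, hr.item_mem⟩ (hprop.1 hp)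
    refine ⟨_, hw.next hu hr hp hbid fun hwin => ?_⟩
    apply le_antisymm (hbid.2 ⟨_, hr.item_mem, rfl⟩)
    obtain ⟨e, he, h⟩ := hbid.1
    rw [← h]
    exact hprop.2 hwin e he

/-- The final value of agent `p` reaches the threshold, provided that `δ` is small compared
with the number of agents. -/
theorem le_scaledValuation_of_isOutcome {v : Finset M → ℝ} (hv : IsSubmodularValuation v)
    (hn : 1 ≤ n) {ρ β δ : ℝ} (hm : 0 < mms n v) (hρ : 0 < ρ) (hβ : 0 < β)
    (hδ : 0 ≤ δ) (hδ' : δ < 1 / 5) (hδn : n * (5 / 6 * δ) < 1)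
    (hδρ : (17 / 10 - δ) * (ρ * β) ≤ β - ρ * β) {p : Fin n} {s : State n M}
    (hs : IsOutcome ρ (fun _ => β) v p s) :
    ρ * β ≤ scaledValuation n v β (s.bundle p) := by
  by_contra! hlt
  have hu := hv.scaledValuation hβ.le hm.le
  have hρβ : 0 < ρ * β := mul_pos hρ hβ
  obtain ⟨w, hw⟩ := exists_ledger hv hβ.le hm hs.1 hlt
  have hrem : s.remaining = ∅ := by
    refine hs.2.resolve_right fun h => h p ?_
    have := hw.budget_eq
    simp only [State.Active]
    linarith
  obtain ⟨A, hA⟩ := exists_partition_scaledValuation_eq (v := v) hn (β := β) hm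
  set f : M → ℝ := fun e => packingWeight (w e / (ρ * β)) with hf
  have hlower : n * (1 - 5 / 6 * δ) ≤ ∑ e ∈ Finset.univ \ s.bundle p, f e := by
    rw [← Finset.sum_fiberwise (Finset.univ \ s.bundle p) A f]
    have := Finset.card_nsmul_le_sum (Finset.univ : Finset (Fin n))
      (fun j => ∑ e ∈ (Finset.univ \ s.bundle p) with A e = j, f e) (1 - 5 / 6 * δ) (by
        intro j _
        have h := hw.le_sum_packingWeight hu hρβ hlt hrem hδ hδ' hδρ (hA j).ge
        have hset : (Finset.univ \ s.bundle p).filter (fun e => A e = j) =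
            Finset.univ.filter (fun e => A e = j) \ s.bundle p := by
          ext e
          simp [and_comm]
        rwa [hset])
    simpa using this
  have hupper : ∑ e ∈ Finset.univ \ s.bundle p, f e ≤ (n : ℝ) - 1 := by
    have hU : Finset.univ \ s.bundle p = (Finset.univ.erase p).biUnion s.bundle := by
      ext e
      simp only [Finset.mem_sdiff, Finset.mem_univ, true_and, Finset.mem_biUnion,
        Finset.mem_erase, and_true]
      constructor
      · intro he
        have : ¬ ∀ i, e ∉ s.bundle i := by
          rw [← hw.mem_remaining, hrem]
          simp
        push Not at this
        obtain ⟨i, hi⟩ := this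
        exact ⟨i, fun h => he (h ▸ hi), hi⟩
      · rintro ⟨i, hip, hi⟩ he
        exact Finset.disjoint_left.1 (hw.disjoint i p hip) hi he
    rw [hU, Finset.sum_biUnion fun i _ j _ hij => hw.disjoint i j hij]
    have := Finset.sum_le_card_nsmul (Finset.univ.erase p) (fun i => ∑ e ∈ s.bundle i, f e) 1
      fun i hi => hw.sum_packingWeight_le_one hρβ (Finset.ne_of_mem_erase hi)
    rw [Finset.card_erase_of_mem (Finset.mem_univ p), Finset.card_univ, Fintype.card_fin,
      nsmul_eq_mul, mul_one, Nat.cast_sub hn, Nat.cast_one] at this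
    exact this
  -- `n * (5 / 6 * δ) < 1` puts the lower bound above `n - 1`.
  linarith

end Game

end BiddingGame

end

/-! ### The constants -/

theorem theorem2 :
    ∃ c : ℝ, 0 < c ∧
      ∀ n : ℕ, 1 ≤ n →
      ∀ ρ : ℝ, 0 < ρ → ρ ≤ 10 / 27 + c / (n : ℝ) →
      ∀ (M : Type*) [Fintype M] [DecidableEq M] (v : Finset M → ℝ),
        BiddingGame.IsSubmodularValuation v →
      ∀ (p : Fin n) (s : BiddingGame.State n M),
        BiddingGame.IsOutcome ρ (fun _ => 1 / (n : ℝ)) v p s →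
        ρ * BiddingGame.mms n v ≤ v (s.bundle p) := by
  refine ⟨1 / 100, by norm_num, ?_⟩
  intro n hn ρ hρ hρn M _ _ v hv p s hs
  rcases le_or_gt (BiddingGame.mms n v) 0 with hm | hm
  · exact (mul_nonpos_of_nonneg_of_nonpos hρ.le hm).trans (hv.nonneg _)
  have hn0 : (0 : ℝ) < n := by exact_mod_cast hn
  have hβ : (0 : ℝ) < 1 / n := by positivity
  have hβ1 : (1 : ℝ) / n ≤ 1 := by
    rw [div_le_one hn0]
    exact_mod_cast hn
  have hρβ : ρ ≤ 10 / 27 + 1 / 100 * (1 / n) := by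
    rwa [div_eq_mul_one_div (1 / 100 : ℝ) (n : ℝ)] at hρn
  have hnβ : (n : ℝ) * (1 / n) = 1 := mul_one_div_cancel hn0.ne'
  -- With `δ = 1 / (10 * n)` the total loss is `1 / 12`. The condition on `ρ` reads `ρ * (27 / 10 -
  -- δ) ≤ 1`; it holds for `c = 1 / 100` because `27 / 1000 < 1 / 27`.
  have key := BiddingGame.le_scaledValuation_of_isOutcome hv hn hm hρ hβ
    (δ := 1 / 10 * (1 / n)) (by positivity) (by linarith) (by linarith) (by
      have h : ρ * (27 / 10 - 1 / 10 * (1 / n)) ≤ 1 := by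
        have h1 : (0 : ℝ) ≤ 27 / 10 - 1 / 10 * (1 / n) := by linarith
        have h2 := mul_le_mul_of_nonneg_right hρβ h1
        nlinarith
      have h3 := mul_le_mul_of_nonneg_right h hβ.le
      linarith) hs
  have h1 : BiddingGame.scaledValuation n v (1 / n) (s.bundle p) ≤
      1 / n / BiddingGame.mms n v * v (s.bundle p) :=
    mul_le_mul_of_nonneg_left (min_le_left _ _) (div_nonneg hβ.le hm.le)
  have h2 := key.trans h1
  rw [div_mul_eq_mul_div, le_div_iff₀ hm] at h2
  have h3 : 1 / (n : ℝ) * (ρ * BiddingGame.mms n v) ≤ 1 / n * v (s.bundle p) := by linarith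
  exact le_of_mul_le_mul_left h3 hβ
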